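/- Let $S\subseteq G^n$ be finite and let $f:S\to H$. All bounds below take values in $[0,\infty]$, with $1/0=\infty$. Define the following classical adversary bounds. * Relational bound: $\mathrm{CA}(f)=\sup_R \min\{\max\{\theta_R(x,i),\theta_R(y,i)\} : x,y\in S,\ i\in[n],\ R(x,y)>0,\ x_i\ne y_i\}$, where $R:S\times S\to\mathbb R_{\ge0}$ ranges over the symmetric, not identically zero functions with $R(x,y)=0$ whenever $f(x)=f(y)$, and $\theta_R(x,i)=\sum_{y\in S}R(x,y)\big/\sum_{y\in S:\,x_i\ne y_i}R(x,y)$. * Rank-1 relational bound: $\mathrm{CA}_1(f)=\sup_{u,v}\min\{\max\{\theta_R(x,i),\theta_R(y,i)\}: x,y\in S,\ i\in[n],\ u(x)v(y)>0,\ x_i\neq y_i\}$, where $u,v:S\to\mathbb R_{\ge0}$ range over the pairs such that $u(x)v(y)=0$ whenever $f(x)=f(y)$ and $u(x)v(y)$ is not identically zero, and $R(x,y)=\max\{u(x)v(y),u(y)v(x)\}$. * Weighted bound: $\mathrm{WA}(f)=\sup_{w,w'}\min\left\{\max\left\{\frac{wt(x)}{v(x,i)},\frac{wt(y)}{v(y,i)}\right\}: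 x,y\in S,\ i\in[n],\ w(x,y)\ne0,\ x_i\ne y_i\right\}$, where $w:S\times S\to\mathbb R_{\ge0}$ is symmetric, not identically zero, and vanishes whenever $f(x)=f(y)$; $w':S\times S\times[n]\to\mathbb R_{\ge0}$ satisfies $w'(x,y,i)=0$ whenever $x_i=y_i$ or $f(x)=f(y)$, and $w'(x,y,i),w'(y,x,i)\ge w(x,y)$ whenever $x_i\ne y_i$; $wt(x)=\sum_{y}w(x,y)$ and $v(x,i)=\sum_y w'(x,y,i)$. * Kolmogorov complexity bound: $\mathrm{KA}(f)=\inf_\sigma\max_{x,y\in S:\,f(x)\ne f(y)}\left(\sum_{i:\,x_i\ne y_i}\min\{2^{-K(i|x,\sigma)},2^{-K(i|y,\sigma)}\}\right)^{-1}$, where $\sigma$ ranges over the finite binary strings. Here $K(a|b)$ is prefix-free Kolmogorov complexity: the length of a shortest admitted program $P$ for which a universal machine $M$ satisfies $M(P,b)=a$ (and $K(a|b)=\infty$, $2^{-\infty}=0$, if there is none), where for each $b$ the set of admitted programs is prefix-free. (The set may be one fixed prefix-free set, or may depend on $b$.) * Minimax bound: $\mathrm{MM}(f)=\inf_p\max_{x,y\in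 S:\,f(x)\ne f(y)}\left(\sum_{i:\,x_i\ne y_i}\min\{p_x(i),p_y(i)\}\right)^{-1}$, where $p=\{p_x\}_{x\in S}$ ranges over the families of probability distributions on $[n]$. For $n\ge1$ let $S_n\subseteq\{0,1\}^n$ be the set of the $n+1$ strings $0^i1^{n-i}$, $0\le i\le n$, and let the ordered search parity function $\mathrm{Osp}_n:S_n\to\{0,1\}$ map $x$ to $\mathrm{Ind}(x)\bmod 2$, where $\mathrm{Ind}(x)$ is the last index $i$ with $x_i=0$ (and $\mathrm{Ind}(1^n)=0$). **Theorem.** For every $n\ge1$, $$\mathrm{CA}_1(\mathrm{Osp}_n)\le2,\qquad \mathrm{CA}(\mathrm{Osp}_n)\le2,\qquad \mathrm{WA}(\mathrm{Osp}_n)\le2 .$$ Moreover $\mathrm{KA}(\mathrm{Osp}_n)=\Omega(\log n)$ and $\mathrm{MM}(\mathrm{Osp}_n)=\Omega(\log n)$: there is an absolute constant $c>0$ such that for every $n\ge1$ we have $\mathrm{MM}(\mathrm{Osp}_n)\ge c\log n$, and $\mathrm{KA}(\mathrm{Osp}_n)\ge c\log n$ for every choice of the universal machine and of the prefix-free sets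 of admitted programs. -/

import Mathlib

open scoped ENNReal NNReal

namespace ClassicalAdversary

/-! Throughout, a partial function `f : S → H` with domain `S ⊆ Gⁿ` is a function `f : S → H`
on (the subtype of) a finite set `S : Finset (Fin n → G)`. All adversary bounds take values in
`[0, ∞]`, where `1 / 0 = ∞`. -/

section Relational

variable {n : ℕ} {G H : Type*} [DecidableEq G] {S : Finset (Fin n → G)}

/-- `θ(x, i) = (∑_y R(x, y)) / (∑_{y : x_i ≠ y_i} R(x, y))`. It is only ever used at points where
the denominator is positive. -/
noncomputable def theta (R : S → S → ℝ≥0) (x : S) (i : Fin n) : ℝ≥0∞ :=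
  ((∑ y, R x y : ℝ≥0) : ℝ≥0∞) / ((∑ y with x.1 i ≠ y.1 i, R x y : ℝ≥0) : ℝ≥0∞)

/-- The relation matrices allowed in the relational adversary bound: symmetric, vanishing on pairs
with equal function values, and not identically zero. -/
structure IsRelation (f : S → H) (R : S → S → ℝ≥0) : Prop where
  symm : ∀ x y, R x y = R y x
  eq_zero : ∀ x y, f x = f y → R x y = 0
  nonzero : ∃ x y, R x y ≠ 0

/-- Relational adversary bound `CA(f)`. -/
noncomputable def CA (f : S → H) : ℝ≥0∞ :=
  ⨆ (R : S → S → ℝ≥0) (_ : IsRelation f R),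
    ⨅ (x : S) (y : S) (i : Fin n) (_ : 0 < R x y ∧ x.1 i ≠ y.1 i),
      max (theta R x i) (theta R y i)

/-- The pairs `u, v` allowed in the rank-1 relational adversary bound: the matrix
`R'(x, y) = u(x) v(y)` vanishes on pairs with equal function values and has rank 1,
that is, it is not identically zero. -/
structure IsRankOne (f : S → H) (u v : S → ℝ≥0) : Prop where
  eq_zero : ∀ x y, f x = f y → u x * v y = 0
  nonzero : ∃ x y, u x * v y ≠ 0

/-- The symmetrised matrix `R(x, y) = max {R'(x, y), R'(y, x)}` with `R'(x, y) = u(x) v(y)`. -/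
noncomputable def rankOneRelation (u v : S → ℝ≥0) (x y : S) : ℝ≥0 :=
  max (u x * v y) (u y * v x)

/-- Rank-1 relational adversary bound `CA₁(f)`. -/
noncomputable def CA₁ (f : S → H) : ℝ≥0∞ :=
  ⨆ (u : S → ℝ≥0) (v : S → ℝ≥0) (_ : IsRankOne f u v),
    ⨅ (x : S) (y : S) (i : Fin n) (_ : 0 < u x * v y ∧ x.1 i ≠ y.1 i),
      max (theta (rankOneRelation u v) x i) (theta (rankOneRelation u v) y i)

/-- Weight schemes `w, w'` allowed in the weighted adversary bound. -/
structure IsWeightScheme (f : S → H) (w : S → S → ℝ≥0) (w' : S → S → Fin n → ℝ≥0) : Prop where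
  symm : ∀ x y, w x y = w y x
  eq_zero : ∀ x y, f x = f y → w x y = 0
  nonzero : ∃ x y, w x y ≠ 0
  eq_zero' : ∀ x y i, (x.1 i = y.1 i ∨ f x = f y) → w' x y i = 0
  le : ∀ x y i, x.1 i ≠ y.1 i → w x y ≤ w' x y i ∧ w x y ≤ w' y x i

/-- Weighted adversary bound `WA(f)`, with `wt(x) = ∑_y w(x, y)` and
`v(x, i) = ∑_y w'(x, y, i)`. -/
noncomputable def WA (f : S → H) : ℝ≥0∞ :=
  ⨆ (w : S → S → ℝ≥0) (w' : S → S → Fin n → ℝ≥0) (_ : IsWeightScheme f w w'),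
    ⨅ (x : S) (y : S) (i : Fin n) (_ : w x y ≠ 0 ∧ x.1 i ≠ y.1 i),
      max (((∑ z, w x z : ℝ≥0) : ℝ≥0∞) / ((∑ z, w' x z i : ℝ≥0) : ℝ≥0∞))
        (((∑ z, w y z : ℝ≥0) : ℝ≥0∞) / ((∑ z, w' y z i : ℝ≥0) : ℝ≥0∞))

/-- Minimax over probability distributions `MM(f)`. -/
noncomputable def MM (f : S → H) : ℝ≥0∞ :=
  ⨅ p : S → PMF (Fin n),
    ⨆ (x : S) (y : S) (_ : f x ≠ f y),
      (∑ i with x.1 i ≠ y.1 i, min (p x i) (p y i))⁻¹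

end Relational

section Kolmogorov

/-- A set of binary strings none of which is a proper prefix of another. -/
def PrefixFree (A : Set (List Bool)) : Prop :=
  ∀ p ∈ A, ∀ q ∈ A, p <+: q → p = q

/-- A universal machine together with a prefix-free choice of programs. The machine `run P y` takes
a program `P` and conditional information `y`; outputs and conditional information are natural
number codes of finite objects. It is universal: every partial computable function is computed by
some program. The admitted programs `programs y` are prefix-free for every given `y`. A fixed
prefix-free set is the case of a constant family; the set of programs on which a self-delimiting
machine halts, given `y`, is another case. -/
structure UniversalPrefixMachine where
  run : List Bool → ℕ →. ℕ
  partrec : Partrec₂ run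
  universal : ∀ φ : ℕ →. ℕ, Partrec φ → ∃ P : List Bool, ∀ y, run P y = φ y
  programs : ℕ → Set (List Bool)
  prefixFree : ∀ y, PrefixFree (programs y)

/-- Prefix-free conditional Kolmogorov complexity `K(a | b)`: the length of a shortest admitted
program that prints `a` when given `b` (`∞` if there is none). -/
noncomputable def K {α β : Type*} [Encodable α] [Encodable β]
    (M : UniversalPrefixMachine) (a : α) (b : β) : ℕ∞ :=
  ⨅ (P : List Bool)
    (_ : P ∈ M.programs (Encodable.encode b) ∧
      Encodable.encode a ∈ M.run P (Encodable.encode b)),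
    (P.length : ℕ∞)

/-- `2^{-k}`, with `2^{-∞} = 0`. -/
noncomputable def twoPowNeg : ℕ∞ → ℝ≥0∞
  | ⊤ => 0
  | (k : ℕ) => (2⁻¹ : ℝ≥0∞) ^ k

variable {n : ℕ} {G H : Type*} [DecidableEq G] [Encodable G] {S : Finset (Fin n → G)}

/-- `K(i | x, σ)` for a position `i` (numbered `1, …, n`) of the word `x`, and a binary
string `σ`. -/
noncomputable def indexComplexity (M : UniversalPrefixMachine) (σ : List Bool) (x : Fin n → G)
    (i : Fin n) : ℕ∞ :=
  K M ((i : ℕ) + 1) (List.ofFn x, σ)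

/-- Kolmogorov complexity adversary bound `KA(f)`. -/
noncomputable def KA (M : UniversalPrefixMachine) (f : S → H) : ℝ≥0∞ :=
  ⨅ σ : List Bool,
    ⨆ (x : S) (y : S) (_ : f x ≠ f y),
      (∑ i with x.1 i ≠ y.1 i,
        min (twoPowNeg (indexComplexity M σ x.1 i)) (twoPowNeg (indexComplexity M σ y.1 i)))⁻¹

end Kolmogorov

section OrderedSearch

open Classical in
/-- The strings in `{0,1}ⁿ` consisting of some number `i ∈ [0; n]` of zeros followed by ones. -/
noncomputable def ospDomain (n : ℕ) : Finset (Fin n → Fin 2) :=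
  {x | ∃ i ≤ n, ∀ j : Fin n, ((j : ℕ) < i → x j = 0) ∧ (i ≤ (j : ℕ) → x j = 1)}

/-- The last position (numbered `1, …, n`) at which `x` is `0`; it is `0` if there is none. -/
def ospInd {n : ℕ} (x : Fin n → Fin 2) : ℕ :=
  Finset.sup {j : Fin n | x j = 0} fun j => (j : ℕ) + 1

/-- The ordered search parity function. -/
noncomputable def osp (n : ℕ) (x : ospDomain n) : Fin 2 :=
  ⟨ospInd x.1 % 2, Nat.mod_lt _ two_pos⟩

end OrderedSearch

end ClassicalAdversary

/-! The string `0^a 1^(n-a)` is the point `a` on the line `0, …, n`, and a query position is a cut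
between two neighbouring points.

Upper bounds: among the points of nonzero weight, let `x` be the rightmost one that sends at least
half of its weight to the right, and let `y` be its nearest right neighbour. By the choice of `x`,
the point `y` sends at least half of its weight to the left. The cut just before `y` is crossed by
all weight from `x` to the right and from `y` to the left, so both ratios there are at most 2
(`exists_balanced_cut`).

Lower bounds: distributions, and by Kraft's inequality also the weights `2^{-K}`, have mass at most
1 on the positions. If the bound is `V`, points at odd distance overlap by at least `1/V` between
them. Weight each pair by its inverse distance: the odd pairs have total weight of order `n log n`,
while `sum_inv_mul_overlap_le` caps the weighted overlap at `2(n+1)`. Hence `V` is at least of order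
`log n`. -/

namespace ClassicalAdversary

/-! ### Strings as points on a line, positions as cuts. -/

section OrderedSearchWords

variable {n : ℕ}

theorem ospDomain_apply {x : Fin n → Fin 2} (hx : x ∈ ospDomain n) :
    ospInd x ≤ n ∧ ∀ i : Fin n, x i = if (i : ℕ) < ospInd x then 0 else 1 := by
  classical
  simp only [ospDomain, Finset.mem_filter, Finset.mem_univ, true_and] at hx
  obtain ⟨a, ha, h⟩ := hx
  have hind : ospInd x = a := by
    apply le_antisymm
    · refine Finset.sup_le fun j hj => ?_
      have hj0 : x j = 0 := by simpa using hj
      by_contra hlt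
      have := (h j).2 (by omega)
      simp [hj0] at this
    · rcases Nat.eq_zero_or_pos a with h0 | hpos
      · omega
      · have hmem : (⟨a - 1, by omega⟩ : Fin n) ∈ ({j : Fin n | x j = 0} : Finset (Fin n)) := by
          simpa using (h ⟨a - 1, by omega⟩).1 (by simp; omega)
        have := Finset.le_sup (f := fun j : Fin n => (j : ℕ) + 1) hmem
        simp only [ospInd]
        dsimp only at this
        omega
  rw [hind]
  refine ⟨ha, fun i => ?_⟩
  split_ifs with hi
  · exact (h i).1 hi
  · exact (h i).2 (by omega)

/-- Positions count from 0 here, so position `i` is the cut between the points `i` and `i + 1`. -/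
theorem ospDomain_ne_iff (x y : ospDomain n) (i : Fin n) :
    x.1 i ≠ y.1 i ↔ (ospInd x.1 ≤ i ∧ (i : ℕ) < ospInd y.1) ∨
      (ospInd y.1 ≤ i ∧ (i : ℕ) < ospInd x.1) := by
  rw [(ospDomain_apply x.2).2 i, (ospDomain_apply y.2).2 i]
  split_ifs <;> simp <;> omega

theorem ospInd_injective : Function.Injective fun x : ospDomain n => ospInd x.1 := by
  intro x y h
  ext1
  funext i
  dsimp only at h
  rw [(ospDomain_apply x.2).2 i, (ospDomain_apply y.2).2 i, h]

/-- The string `0^a 1^(n - a)`. -/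
noncomputable def ospWord (n a : ℕ) : ospDomain n :=
  ⟨fun i => if (i : ℕ) < a then 0 else 1, by
    classical
    simp only [ospDomain, Finset.mem_filter, Finset.mem_univ, true_and]
    -- Capping at `n` makes the word meaningful for every `a`; beyond `n` it is all zeros.
    refine ⟨min a n, min_le_right _ _, fun j => ⟨fun h => ?_, fun h => ?_⟩⟩
    · rw [if_pos (by omega)]
    · rw [if_neg (by omega)]⟩

theorem ospInd_ospWord {a : ℕ} (ha : a ≤ n) : ospInd (ospWord n a).1 = a := by
  have h := ospDomain_apply (ospWord n a).2
  set m := ospInd (ospWord n a).1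
  by_contra hne
  have key : ∀ i : Fin n, (i : ℕ) < a ↔ (i : ℕ) < m := by
    intro i
    have := h.2 i
    simp only [ospWord] at this
    split_ifs at this <;> omega
  rcases lt_or_gt_of_ne hne with hlt | hlt
  · have := key ⟨m, by omega⟩
    simp at this; omega
  · have := key ⟨a, by omega⟩
    simp at this; omega

end OrderedSearchWords

/-! ### Upper bounds from a balanced cut. -/

section UpperBounds

variable {n : ℕ}

/-- A symmetric nonzero weight function on the ordered search domain has a pair `x, y` of positive
weight and a position `i` separating it such that both `x` and `y` send at least half of their
weight across `i`. -/
theorem exists_balanced_cut (R : ospDomain n → ospDomain n → ℝ≥0) (symm : ∀ x y, R x y = R y x)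
    (diag : ∀ x, R x x = 0) (nonzero : ∃ x y, R x y ≠ 0) :
    ∃ (x y : ospDomain n) (i : Fin n), R x y ≠ 0 ∧ x.1 i ≠ y.1 i ∧
      (∑ z, R x z) ≤ 2 * (∑ z with x.1 i ≠ z.1 i, R x z) ∧
      (∑ z, R y z) ≤ 2 * (∑ z with y.1 i ≠ z.1 i, R y z) := by
  classical
  let ind : ospDomain n → ℕ := fun x => ospInd x.1
  have hinj : Function.Injective ind := ospInd_injective
  have split : ∀ x, (∑ z, R x z) =
      (∑ z with ind x < ind z, R x z) + ∑ z with ind z < ind x, R x z := by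
    intro x
    rw [Finset.sum_filter, Finset.sum_filter, ← Finset.sum_add_distrib]
    refine Finset.sum_congr rfl fun z _ => ?_
    rcases lt_trichotomy (ind x) (ind z) with h | h | h
    · rw [if_pos h, if_neg (by omega), add_zero]
    · rw [← hinj h]; simp [diag]
    · rw [if_neg (by omega), if_pos h, zero_add]
  -- Isolated points satisfy the inequality trivially and must be excluded. The leftmost
  -- non-isolated point belongs to this set, having no weight to its left.
  let right : Finset (ospDomain n) := {x | (∃ z, R x z ≠ 0) ∧
    (∑ z, R x z) ≤ 2 * ∑ z with ind x < ind z, R x z}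
  have right_nonempty : right.Nonempty := by
    obtain ⟨a, b, hab⟩ := nonzero
    obtain ⟨x, hx, hmin⟩ := Finset.exists_min_image
      ({x | ∃ z, R x z ≠ 0} : Finset (ospDomain n)) ind ⟨a, by simpa using ⟨_, _, hab⟩⟩
    refine ⟨x, ?_⟩
    simp only [right, Finset.mem_filter, Finset.mem_univ, true_and] at hx hmin ⊢
    refine ⟨hx, ?_⟩
    have h0 : ∑ z with ind z < ind x, R x z = 0 := by
      refine Finset.sum_eq_zero fun z hz => ?_
      by_contra hne
      have := hmin z ⟨x, by rwa [symm]⟩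
      have := (Finset.mem_filter.1 hz).2
      omega
    rw [split x, h0, add_zero, two_mul]
    exact le_add_of_nonneg_left zero_le
  obtain ⟨x, hx, hmax⟩ := Finset.exists_max_image right ind right_nonempty
  simp only [right, Finset.mem_filter, Finset.mem_univ, true_and] at hx
  obtain ⟨⟨w, hw⟩, hx⟩ := hx
  have nbr : ({z | ind x < ind z ∧ R x z ≠ 0} : Finset (ospDomain n)).Nonempty := by
    by_contra hempty
    have h0 : ∑ z with ind x < ind z, R x z = 0 := by
      refine Finset.sum_eq_zero fun z hz => ?_
      by_contra hne
      exact hempty ⟨z, by simpa using ⟨(Finset.mem_filter.1 hz).2, hne⟩⟩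
    rw [h0, mul_zero] at hx
    have := Finset.single_le_sum (f := fun z => R x z) (fun _ _ => zero_le) (Finset.mem_univ w)
    exact hw (le_antisymm (this.trans hx) zero_le)
  obtain ⟨y, hy, hmin⟩ := Finset.exists_min_image _ ind nbr
  simp only [Finset.mem_filter, Finset.mem_univ, true_and] at hy hmin
  obtain ⟨hxy, hR⟩ := hy
  have hyn : ind y ≤ n := (ospDomain_apply y.2).1
  have hne : ∀ (u v : ospDomain n) (i : Fin n), u.1 i ≠ v.1 i ↔
      (ind u ≤ i ∧ (i : ℕ) < ind v) ∨ (ind v ≤ i ∧ (i : ℕ) < ind u) := ospDomain_ne_iff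
  -- `y` lies to the right of the maximal element `x` and is not isolated, so it fails the condition
  -- defining `right`.
  have hyleft : (∑ z, R y z) ≤ 2 * ∑ z with ind z < ind y, R y z := by
    have hnot : ¬ (∑ z, R y z) ≤ 2 * ∑ z with ind y < ind z, R y z := by
      intro h
      have := hmax y (by simpa [right] using ⟨⟨x.1, x.2, by rwa [symm]⟩, h⟩)
      omega
    rw [split y, two_mul] at hnot ⊢
    have := (not_le.1 hnot)
    have := lt_of_add_lt_add_left this
    gcongr
  -- The cut just before `y`. No neighbour of `x` lies strictly between `x` and `y`, so every right
  -- neighbour of `x` is beyond it.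
  refine ⟨x, y, ⟨ind y - 1, by omega⟩, hR, ?_, hx.trans ?_, hyleft.trans ?_⟩
  · rw [hne]; simp; omega
  · refine mul_le_mul_right (Finset.sum_le_sum_of_ne_zero fun z hz hz0 => ?_) _
    have hz := (Finset.mem_filter.1 hz).2
    have := hmin z ⟨hz, hz0⟩
    rw [Finset.mem_filter, hne]; simp; omega
  · refine mul_le_mul_right (Finset.sum_le_sum_of_subset fun z hz => ?_) _
    have hz := (Finset.mem_filter.1 hz).2
    rw [Finset.mem_filter, hne]; simp; omega

theorem coe_div_coe_le_two {a b : ℝ≥0} (h : a ≤ 2 * b) : (a : ℝ≥0∞) / b ≤ 2 :=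
  ENNReal.div_le_of_le_mul (by exact_mod_cast h)

theorem CA_osp_le (n : ℕ) : CA (osp n) ≤ 2 := by
  refine iSup₂_le fun R hR => ?_
  obtain ⟨x, y, i, hxy, hi, hx, hy⟩ := exists_balanced_cut R hR.symm
    (fun x => hR.eq_zero x x rfl) hR.nonzero
  refine iInf_le_of_le x <| iInf_le_of_le y <| iInf_le_of_le i <|
    iInf_le_of_le ⟨pos_iff_ne_zero.2 hxy, hi⟩ <| max_le ?_ ?_
  · exact coe_div_coe_le_two hx
  · exact coe_div_coe_le_two hy

theorem CA₁_osp_le (n : ℕ) : CA₁ (osp n) ≤ 2 := by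
  refine iSup₂_le fun u v => iSup_le fun h => ?_
  obtain ⟨x, y, i, hxy, hi, hx, hy⟩ := exists_balanced_cut (rankOneRelation u v)
    (fun x y => max_comm _ _) (fun x => by simp [rankOneRelation, h.eq_zero x x rfl]) (by
      obtain ⟨x, y, hxy⟩ := h.nonzero
      exact ⟨x, y, ((pos_iff_ne_zero.2 hxy).trans_le (le_max_left _ _)).ne'⟩)
  have hpos : 0 < u x * v y ∨ 0 < u y * v x := lt_max_iff.1 (pos_iff_ne_zero.2 hxy)
  rcases hpos with hpos | hpos
  · exact iInf_le_of_le x <| iInf_le_of_le y <| iInf_le_of_le i <|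
      iInf_le_of_le ⟨hpos, hi⟩ <| max_le (coe_div_coe_le_two hx) (coe_div_coe_le_two hy)
  · exact iInf_le_of_le y <| iInf_le_of_le x <| iInf_le_of_le i <|
      iInf_le_of_le ⟨hpos, hi.symm⟩ <| max_le (coe_div_coe_le_two hy) (coe_div_coe_le_two hx)

/-- Since `w'` dominates `w` on separated pairs, `v(x, i)` is at least the `w`-weight that `x` sends
across `i`. -/
theorem WA_osp_le (n : ℕ) : WA (osp n) ≤ 2 := by
  refine iSup₂_le fun w w' => iSup_le fun h => ?_
  obtain ⟨x, y, i, hxy, hi, hx, hy⟩ := exists_balanced_cut w h.symm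
    (fun x => h.eq_zero x x rfl) h.nonzero
  have key : ∀ x, 2 * (∑ z with x.1 i ≠ z.1 i, w x z) ≤ 2 * ∑ z, w' x z i := by
    intro x
    refine mul_le_mul_right ?_ _
    refine (Finset.sum_le_sum fun z hz => (h.le x z i (Finset.mem_filter.1 hz).2).1).trans ?_
    exact Finset.sum_le_sum_of_subset (Finset.filter_subset _ _)
  exact iInf_le_of_le x <| iInf_le_of_le y <| iInf_le_of_le i <| iInf_le_of_le ⟨hxy, hi⟩ <|
    max_le (coe_div_coe_le_two (hx.trans (key x))) (coe_div_coe_le_two (hy.trans (key y)))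

end UpperBounds

/-! ### A Hilbert-type inequality and the logarithmic lower bound. -/

section HilbertTypeInequality

theorem sum_ite_inv_mul_le {ι : Type*} (s : Finset ι) (P : ι → Prop) [DecidablePred P] (m : ℕ)
    (c : ℝ≥0∞) (h : (s.filter P).card ≤ m) :
    (∑ i ∈ s, if P i then (m : ℝ≥0∞)⁻¹ * c else 0) ≤ c := by
  rw [← Finset.sum_filter, Finset.sum_const, nsmul_eq_mul, ← mul_assoc]
  calc ((s.filter P).card : ℝ≥0∞) * (m : ℝ≥0∞)⁻¹ * c ≤ (m : ℝ≥0∞) * (m : ℝ≥0∞)⁻¹ * c := by gcongr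
    _ ≤ 1 * c := by gcongr; exact ENNReal.mul_inv_le_one _
    _ = c := one_mul c

/-- A Hilbert-type inequality: if each `q a` has total mass at most one, then the overlaps of
`q a` and `q b` on `[a, b)`, weighted by `1 / (b - a)`, add up to `O(n)`. -/
theorem sum_inv_mul_overlap_le {n : ℕ} (q : ℕ → Fin n → ℝ≥0∞) (hq : ∀ a, ∑ i, q a i ≤ 1) :
    (∑ a ∈ Finset.range (n + 1), ∑ b ∈ Finset.range (n + 1), if a < b then
      ((b - a : ℕ) : ℝ≥0∞)⁻¹ *
        ∑ i ∈ Finset.univ.filter fun i : Fin n => a ≤ (i : ℕ) ∧ (i : ℕ) < b,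
          min (q a i) (q b i) else 0) ≤
      2 * ((n + 1 : ℕ) : ℝ≥0∞) := by
  have hsum : ∑ a ∈ Finset.range (n + 1), ∑ i, q a i ≤ ((n + 1 : ℕ) : ℝ≥0∞) := by
    refine (Finset.sum_le_sum fun a _ => hq a).trans ?_
    simp
  -- Each position is charged to the farther endpoint of its pair. Here that is `a`: the mass `q a
  -- i` is charged by at most `i + 1 - a` values of `b`, each time with factor `1 / (i + 1 - a)`,
  -- hence at most once in total.
  have hfirst : (∑ a ∈ Finset.range (n + 1), ∑ b ∈ Finset.range (n + 1), ∑ i : Fin n,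
      if a ≤ (i : ℕ) ∧ (i : ℕ) < b ∧ a + b ≤ 2 * i + 1 then
        ((i + 1 - a : ℕ) : ℝ≥0∞)⁻¹ * q a i else 0) ≤ ((n + 1 : ℕ) : ℝ≥0∞) := by
    refine le_trans (Finset.sum_le_sum fun a _ => ?_) hsum
    rw [Finset.sum_comm]
    refine Finset.sum_le_sum fun i _ => sum_ite_inv_mul_le _ _ _ _ ?_
    calc _ ≤ (Finset.Ioc (i : ℕ) (2 * i + 1 - a)).card := by
          refine Finset.card_le_card fun b hb => ?_
          simp only [Finset.mem_filter, Finset.mem_Ioc] at hb ⊢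
          omega
      _ ≤ _ := by rw [Nat.card_Ioc]; omega
  -- The mirror image, for positions charged to `b`.
  have hsecond : (∑ a ∈ Finset.range (n + 1), ∑ b ∈ Finset.range (n + 1), ∑ i : Fin n,
      if a ≤ (i : ℕ) ∧ (i : ℕ) < b ∧ 2 * i + 1 < a + b then
        ((b - i : ℕ) : ℝ≥0∞)⁻¹ * q b i else 0) ≤ ((n + 1 : ℕ) : ℝ≥0∞) := by
    rw [Finset.sum_comm]
    refine le_trans (Finset.sum_le_sum fun b _ => ?_) hsum
    rw [Finset.sum_comm]
    refine Finset.sum_le_sum fun i _ => sum_ite_inv_mul_le _ _ _ _ ?_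
    rcases Nat.lt_or_ge (i : ℕ) b with hib | hib
    · calc _ ≤ (Finset.Ico (2 * (i : ℕ) + 2 - b) (i + 1)).card := by
            refine Finset.card_le_card fun a ha => ?_
            simp only [Finset.mem_filter, Finset.mem_Ico] at ha ⊢
            omega
        _ ≤ _ := by rw [Nat.card_Ico]; omega
    -- Here `b - i` truncates to 0 and its inverse is infinite, but no `a` qualifies.
    · rw [Finset.filter_false_of_mem fun a _ h => by omega]
      simp
  rw [two_mul]
  refine le_trans ?_ (add_le_add hfirst hsecond)
  rw [← Finset.sum_add_distrib]
  refine Finset.sum_le_sum fun a _ => ?_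
  rw [← Finset.sum_add_distrib]
  refine Finset.sum_le_sum fun b _ => ?_
  split_ifs with hab
  swap
  · exact zero_le
  rw [← Finset.sum_add_distrib, Finset.mul_sum, Finset.sum_filter]
  refine Finset.sum_le_sum fun i _ => ?_
  by_cases hi : a ≤ (i : ℕ) ∧ (i : ℕ) < b
  swap
  · rw [if_neg hi]; exact zero_le
  rw [if_pos hi]
  by_cases hh : a + b ≤ 2 * (i : ℕ) + 1
  · rw [if_pos ⟨hi.1, hi.2, hh⟩]
    refine le_trans ?_ (le_add_of_nonneg_right zero_le)
    gcongr
    · omega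
    · exact min_le_left _ _
  · rw [if_pos (⟨hi.1, hi.2, by omega⟩ : a ≤ (i : ℕ) ∧ (i : ℕ) < b ∧ 2 * (i : ℕ) + 1 < a + b)]
    refine le_trans ?_ (le_add_of_nonneg_left zero_le)
    gcongr
    · omega
    · exact min_le_right _ _

/-- Termwise `1/(k+1) ≤ 2/(2k+1)`, so the sum is at least half a harmonic number. -/
theorem log_le_sum_inv_odd (B : ℕ) :
    ENNReal.ofReal (Real.log (B + 1) / 2) ≤
      ∑ k ∈ Finset.range B, ((2 * k + 1 : ℕ) : ℝ≥0∞)⁻¹ := by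
  have hcast : ∑ k ∈ Finset.range B, ((2 * k + 1 : ℕ) : ℝ≥0∞)⁻¹ =
      ENNReal.ofReal (∑ k ∈ Finset.range B, ((2 * k + 1 : ℕ) : ℝ)⁻¹) := by
    rw [ENNReal.ofReal_sum_of_nonneg fun k _ => by positivity]
    refine Finset.sum_congr rfl fun k _ => ?_
    rw [ENNReal.ofReal_inv_of_pos (by positivity), ENNReal.ofReal_natCast]
  rw [hcast]
  apply ENNReal.ofReal_le_ofReal
  have h := log_add_one_le_harmonic B
  have h2 : ((harmonic B : ℚ) : ℝ) ≤ 2 * ∑ k ∈ Finset.range B, ((2 * k + 1 : ℕ) : ℝ)⁻¹ := by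
    simp only [harmonic]
    push_cast
    rw [Finset.mul_sum]
    refine Finset.sum_le_sum fun k _ => ?_
    rw [inv_eq_one_div, ← div_eq_mul_inv, div_le_div_iff₀ (by positivity) (by positivity)]
    linarith
  push_cast at h h2 ⊢
  linarith

/-- Double counting: `A` left endpoints, each with the `B` odd distances below `2 * B`, give
weighted overlap at least `A * h / V`, against the upper bound `2 * (n + 1)`. -/
theorem log_le_of_inv_le_overlap {n : ℕ} (hn : 1 ≤ n) (q : ℕ → Fin n → ℝ≥0∞)
    (hq : ∀ a, ∑ i, q a i ≤ 1) (V : ℝ≥0∞)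
    (hV : ∀ a k, a + 2 * k + 1 ≤ n → V⁻¹ ≤
      ∑ i ∈ Finset.univ.filter fun i : Fin n => a ≤ (i : ℕ) ∧ (i : ℕ) < a + 2 * k + 1,
        min (q a i) (q (a + 2 * k + 1) i)) :
    ENNReal.ofReal (1 / 24 * Real.log n) ≤ V := by
  -- `n + 2 - 2 * B` is the number of `a` for which even the longest distance `2 * B - 1` stays
  -- within `n`. With `B` about `n / 4`, at least half of the points remain, so `h / V ≤ 4`. The
  -- minimum handles `B = 0`.
  obtain ⟨B, hB⟩ : ∃ B, B = (n + 2) / 4 := ⟨_, rfl⟩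
  obtain ⟨A, hA⟩ : ∃ A, A = min (n + 1) (n + 2 - 2 * B) := ⟨_, rfl⟩
  set h : ℝ≥0∞ := ∑ k ∈ Finset.range B, ((2 * k + 1 : ℕ) : ℝ≥0∞)⁻¹ with hh
  have hlow : (A : ℝ≥0∞) * (h * V⁻¹) ≤ 2 * ((n + 1 : ℕ) : ℝ≥0∞) := by
    refine le_trans ?_ (sum_inv_mul_overlap_le q hq)
    calc (A : ℝ≥0∞) * (h * V⁻¹) = ∑ a ∈ Finset.range A, h * V⁻¹ := by simp
      _ ≤ _ := Finset.sum_le_sum fun a ha => ?_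
      _ ≤ _ := Finset.sum_le_sum_of_subset (Finset.range_subset_range.2 (by omega : A ≤ n + 1))
    have ha := Finset.mem_range.1 ha
    rw [hh, Finset.sum_mul]
    have hinj : Set.InjOn (fun k => a + 2 * k + 1) (Finset.range B : Set ℕ) :=
      fun k _ l _ hkl => by dsimp only at hkl; omega
    refine le_trans ?_ (Finset.sum_le_sum_of_subset
      (s := (Finset.range B).image fun k => a + 2 * k + 1) ?_)
    · rw [Finset.sum_image hinj]
      refine Finset.sum_le_sum fun k hk => ?_
      have hk := Finset.mem_range.1 hk
      rw [if_pos (by omega), show a + 2 * k + 1 - a = 2 * k + 1 by omega]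
      gcongr
      exact hV a k (by omega)
    · intro b hb
      obtain ⟨k, hk, rfl⟩ := Finset.mem_image.1 hb
      have hk := Finset.mem_range.1 hk
      rw [Finset.mem_range]
      omega
  have hA0 : (A : ℝ≥0∞) ≠ 0 := by
    rw [Nat.cast_ne_zero]; omega
  have hfour : h / V ≤ 4 := by
    rw [div_eq_mul_inv]
    refine (ENNReal.mul_le_mul_iff_right hA0 (ENNReal.natCast_ne_top A)).1 (hlow.trans ?_)
    have : 2 * (n + 1) ≤ A * 4 := by omega
    exact_mod_cast this
  rw [ENNReal.div_le_iff_le_mul (by simp) (by simp)] at hfour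
  have hlog : ENNReal.ofReal (1 / 24 * Real.log n) * 4 ≤ h := by
    refine le_trans ?_ (log_le_sum_inv_odd B)
    rw [show (4 : ℝ≥0∞) = ENNReal.ofReal 4 by simp, ← ENNReal.ofReal_mul' (by norm_num)]
    apply ENNReal.ofReal_le_ofReal
    -- The cube absorbs `n ≤ 4 * B + 1` at the cost of a factor 3 in the logarithm; the constant is
    -- `1/24 = 1/(4 · 3 · 2)`.
    have hcube : (n : ℝ) ≤ ((B : ℝ) + 1) ^ 3 := by
      have : n ≤ (B + 1) ^ 3 := by
        have : n ≤ 4 * B + 1 := by omega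
        refine this.trans ?_
        nlinarith [sq_nonneg B, Nat.le_self_pow two_ne_zero B, Nat.zero_le (B ^ 3)]
      exact_mod_cast this
    have := Real.log_le_log (by exact_mod_cast hn) hcube
    rw [Real.log_pow] at this
    push_cast at this
    linarith
  rw [mul_comm] at hlog
  exact (ENNReal.mul_le_mul_iff_right (by simp) (by simp)).1 (hlog.trans hfour)

/-- Only total mass at most one is required, so that `MM` and `KA` are covered alike. -/
theorem log_le_iSup_osp {n : ℕ} (hn : 1 ≤ n) (q : ospDomain n → Fin n → ℝ≥0∞)
    (hq : ∀ x, ∑ i, q x i ≤ 1) :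
    ENNReal.ofReal (1 / 24 * Real.log n) ≤
      ⨆ (x : ospDomain n) (y : ospDomain n) (_ : osp n x ≠ osp n y),
        (∑ i with x.1 i ≠ y.1 i, min (q x i) (q y i))⁻¹ := by
  refine log_le_of_inv_le_overlap hn (fun a => q (ospWord n a)) (fun a => hq _) _ fun a k hk => ?_
  have ha : ospInd (ospWord n a).1 = a := ospInd_ospWord (by omega)
  have hb : ospInd (ospWord n (a + 2 * k + 1)).1 = a + 2 * k + 1 := ospInd_ospWord hk
  have hne : osp n (ospWord n a) ≠ osp n (ospWord n (a + 2 * k + 1)) := by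
    -- Odd distance forces different parities.
    simp only [osp, ha, hb, ne_eq, Fin.mk.injEq]
    omega
  rw [ENNReal.inv_le_iff_inv_le]
  refine le_trans (le_of_eq ?_) (le_iSup_of_le (ospWord n a) <|
    le_iSup_of_le (ospWord n (a + 2 * k + 1)) <| le_iSup_of_le hne le_rfl)
  congr 2
  ext i
  simp only [Finset.mem_filter, Finset.mem_univ, true_and, ospDomain_ne_iff, ha, hb]
  omega

end HilbertTypeInequality

/-! ### Kraft's inequality for conditional complexity. -/

section KraftInequality

/-- The first words of two factorisations are prefixes of one word, hence comparable, hence equal;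
cancel and induct. The empty word could be inserted freely. -/
theorem PrefixFree.uniquelyDecodable {A : Set (List Bool)} (hA : PrefixFree A) (h0 : [] ∉ A) :
    InformationTheory.UniquelyDecodable A := by
  intro L₁
  induction L₁ with
  | nil =>
    intro L₂ _ h₂ h
    cases L₂ with
    | nil => rfl
    | cons w L =>
      simp only [List.flatten_nil, List.flatten_cons, List.nil_eq, List.append_eq_nil_iff] at h
      exact absurd (h.1 ▸ h₂ w (by simp)) h0
  | cons v L₁ ih =>
    intro L₂ h₁ h₂ h
    cases L₂ with
    | nil =>
      simp only [List.flatten_nil, List.flatten_cons, List.append_eq_nil_iff] at h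
      exact absurd (h.1 ▸ h₁ v (by simp)) h0
    | cons w L₂ =>
      have hv := h₁ v (by simp)
      have hw := h₂ w (by simp)
      simp only [List.flatten_cons] at h
      have hvw : v = w := by
        rcases List.prefix_or_prefix_of_prefix (List.prefix_append v L₁.flatten)
          (h ▸ List.prefix_append w L₂.flatten) with hp | hp
        · exact hA v hv w hw hp
        · exact (hA w hw v hv hp).symm
      subst hvw
      rw [ih L₂ (fun u hu => h₁ u (by simp [hu])) (fun u hu => h₂ u (by simp [hu]))
        (List.append_cancel_left h)]

theorem PrefixFree.sum_two_inv_pow_le_one {A : Set (List Bool)} (hA : PrefixFree A)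
    (T : Finset (List Bool)) (hT : ∀ w ∈ T, w ∈ A) :
    ∑ w ∈ T, (2⁻¹ : ℝ≥0∞) ^ w.length ≤ 1 := by
  by_cases h0 : [] ∈ T
  -- The empty word is a prefix of everything, so it is alone and the sum is 1.
  · have : T = {[]} := by
      refine Finset.eq_singleton_iff_unique_mem.2 ⟨h0, fun w hw => ?_⟩
      exact (hA [] (hT _ h0) w (hT _ hw) List.nil_prefix).symm
    simp [this]
  · have hTfree : PrefixFree (T : Set (List Bool)) :=
      fun p hp r hr => hA p (hT p hp) r (hT r hr)
    have h := InformationTheory.kraft_mcmillan_inequality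
      (hTfree.uniquelyDecodable (by simpa using h0))
    rw [Fintype.card_bool] at h
    have hcast : ∑ w ∈ T, (2⁻¹ : ℝ≥0∞) ^ w.length =
        ENNReal.ofReal (∑ w ∈ T, (1 / (2 : ℕ) : ℝ) ^ w.length) := by
      rw [ENNReal.ofReal_sum_of_nonneg fun _ _ => by positivity]
      refine Finset.sum_congr rfl fun w _ => ?_
      rw [ENNReal.ofReal_pow (by positivity), one_div, ENNReal.ofReal_inv_of_pos (by positivity)]
      simp
    rw [hcast]
    exact ENNReal.ofReal_le_one.2 h

theorem exists_program_of_K_ne_top {α β : Type*} [Encodable α] [Encodable β]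
    (M : UniversalPrefixMachine) (a : α) (b : β) (h : K M a b ≠ ⊤) :
    ∃ P ∈ M.programs (Encodable.encode b), Encodable.encode a ∈ M.run P (Encodable.encode b) ∧
      K M a b = P.length := by
  let good : Set (List Bool) := {P | P ∈ M.programs (Encodable.encode b) ∧
    Encodable.encode a ∈ M.run P (Encodable.encode b)}
  have hK : K M a b = sInf ((fun P : List Bool => (P.length : ℕ∞)) '' good) := by
    rw [sInf_image]; rfl
  have hne : ((fun P : List Bool => (P.length : ℕ∞)) '' good).Nonempty := by
    by_contra hempty
    rw [Set.not_nonempty_iff_eq_empty.1 hempty, sInf_empty] at hK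
    exact h hK
  obtain ⟨P, hP, hlen⟩ := csInf_mem hne
  exact ⟨P, hP.1, hP.2, hK.trans hlen.symm⟩

/-- Kraft's inequality for prefix-free Kolmogorov complexity. -/
theorem sum_twoPowNeg_K_le_one {ι α β : Type*} [Encodable α] [Encodable β]
    (M : UniversalPrefixMachine) (s : Finset ι) (a : ι → α) (ha : Function.Injective a) (b : β) :
    ∑ i ∈ s, twoPowNeg (K M (a i) b) ≤ 1 := by
  classical
  have hprog : ∀ i, ∃ P : List Bool, K M (a i) b ≠ ⊤ →
      P ∈ M.programs (Encodable.encode b) ∧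
      Encodable.encode (a i) ∈ M.run P (Encodable.encode b) ∧ K M (a i) b = P.length := by
    intro i
    by_cases h : K M (a i) b = ⊤
    -- A dummy program: such `i` contribute 0 and are dropped from `t`.
    · exact ⟨[], fun h' => absurd h h'⟩
    · obtain ⟨P, h1, h2, h3⟩ := exists_program_of_K_ne_top M (a i) b h
      exact ⟨P, fun _ => ⟨h1, h2, h3⟩⟩
  choose P hP using hprog
  let t := s.filter fun i => K M (a i) b ≠ ⊤
  -- A program has at most one output on a given condition, so distinct values have distinct
  -- shortest programs.
  have hinj : Set.InjOn P (t : Set ι) := by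
    intro i hi j hj hij
    have h1 := (hP i (Finset.mem_filter.1 hi).2).2.1
    have h2 := (hP j (Finset.mem_filter.1 hj).2).2.1
    rw [hij] at h1
    exact ha (Encodable.encode_injective (Part.mem_unique h1 h2))
  have hsum : ∑ i ∈ s, twoPowNeg (K M (a i) b) = ∑ i ∈ t, (2⁻¹ : ℝ≥0∞) ^ (P i).length := by
    rw [Finset.sum_filter]
    refine Finset.sum_congr rfl fun i _ => ?_
    split_ifs with h
    · rw [(hP i h).2.2]; rfl
    · rw [not_not.1 h]; rfl
  rw [hsum, ← Finset.sum_image (f := fun w : List Bool => (2⁻¹ : ℝ≥0∞) ^ w.length) hinj]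
  refine (M.prefixFree (Encodable.encode b)).sum_two_inv_pow_le_one _ fun w hw => ?_
  obtain ⟨i, hi, rfl⟩ := Finset.mem_image.1 hw
  exact (hP i (Finset.mem_filter.1 hi).2).1

end KraftInequality

/-! ### Lower bounds for `KA` and `MM`. -/

theorem log_le_KA_osp {n : ℕ} (hn : 1 ≤ n) (M : UniversalPrefixMachine) :
    ENNReal.ofReal (1 / 24 * Real.log n) ≤ KA M (osp n) := by
  refine le_iInf fun σ => log_le_iSup_osp hn
    (fun x i => twoPowNeg (indexComplexity M σ x.1 i)) fun x => ?_
  exact sum_twoPowNeg_K_le_one M Finset.univ (fun i : Fin n => (i : ℕ) + 1)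
    (fun i j h => Fin.ext (by simpa using h)) _

theorem log_le_MM_osp {n : ℕ} (hn : 1 ≤ n) :
    ENNReal.ofReal (1 / 24 * Real.log n) ≤ MM (osp n) := by
  refine le_iInf fun p => log_le_iSup_osp hn (fun x i => p x i) fun x => ?_
  exact ((tsum_fintype (p x)).symm.trans (p x).tsum_coe).le

end ClassicalAdversary

theorem mainTheorem3 :
    (∀ n : ℕ, 1 ≤ n →
      ClassicalAdversary.CA₁ (ClassicalAdversary.osp n) ≤ 2 ∧
      ClassicalAdversary.CA (ClassicalAdversary.osp n) ≤ 2 ∧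
      ClassicalAdversary.WA (ClassicalAdversary.osp n) ≤ 2) ∧
    ∃ c : ℝ, 0 < c ∧ ∀ n : ℕ, 1 ≤ n →
      (∀ M : ClassicalAdversary.UniversalPrefixMachine,
        ENNReal.ofReal (c * Real.log n) ≤
          ClassicalAdversary.KA M (ClassicalAdversary.osp n)) ∧
      ENNReal.ofReal (c * Real.log n) ≤
        ClassicalAdversary.MM (ClassicalAdversary.osp n) :=
  ⟨fun n _ => ⟨ClassicalAdversary.CA₁_osp_le n, ClassicalAdversary.CA_osp_le n,
      ClassicalAdversary.WA_osp_le n⟩,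
    1 / 24, by norm_num, fun _ hn => ⟨fun M => ClassicalAdversary.log_le_KA_osp hn M,
      ClassicalAdversary.log_le_MM_osp hn⟩⟩
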